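/- **Setting.** A literal is a proposition $p$ or its negation $\neg p$; ${\sim}q$ is the complement of $q$. A defeasible theory $D=(F,R,>)$ consists of a set $F$ of literals (facts), a finite set $R$ of rules with pairwise distinct labels, and an acyclic relation $>$ on labels. A rule has a set of literals as body, a literal as head, and is strict, defeasible, or a defeater. Write $R[q]$, $R_s[q]$, $R_{sd}[q]$ for the sets of all, of strict, and of strict or defeasible rules with head $q$, and $A(r)$ for the body of $r$. $\Sigma(D)$ is the set of literals occurring in $D$, closed under complement, and $\Lambda(D)$ is the set of labels occurring in $D$. Conclusions have the form $+d\,q$ or $-d\,q$ for a tag $d$. The conclusions of $D$ are the elements of the least fixed point of the monotone operator $\mathcal T_D$ given as follows. Here, for a rule $r$, "$+d\,A(r)$" means $+d\,a\in E$ for all $a\in A(r)$, and "$-d\,A(r)$" means $-d\,a\in E$ for some $a\in A(r)$. * $+\Delta q\in\mathcal T_D(E)$ iff $q\in F$ or there is $r\in R_s[q]$ with $+\Delta A(r)$. $-\Delta q\in\mathcal T_D(E)$ iff $q\notin F$ and $-\Delta A(r)$ for all $r\in R_s[q]$. * Team defeat, for $(d,d')=(\partial,\partial)$ and $(d,d')=(\delta,\sigma)$.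 $+d\,q\in\mathcal T_D(E)$ iff $+\Delta q\in E$, or: some $r\in R_{sd}[q]$ has $+d\,A(r)$; $-\Delta{\sim}q\in E$; and for each $s\in R[{\sim}q]$ either $-d'A(s)$ or some $t\in R_{sd}[q]$ has $+d\,A(t)$ and $t>s$. $-d\,q\in\mathcal T_D(E)$ iff $-\Delta q\in E$ and one of: $-d\,A(r)$ for all $r\in R_{sd}[q]$; $+\Delta{\sim}q\in E$; some $s\in R[{\sim}q]$ has $+d'A(s)$ and every $t\in R_{sd}[q]$ has $-d\,A(t)$ or $t\not>s$. * Individual defeat, for $(d,d')=(\partial^*,\partial^*)$ and $(d,d')=(\delta^*,\sigma^*)$. $+d\,q\in\mathcal T_D(E)$ iff $+\Delta q\in E$, or some $r\in R_{sd}[q]$ has $+d\,A(r)$, $-\Delta{\sim}q\in E$, and for each $s\in R[{\sim}q]$ either $-d'A(s)$ or $r>s$. $-d\,q\in\mathcal T_D(E)$ iff $-\Delta q\in E$ and for each $r\in R_{sd}[q]$ one of: $-d\,A(r)$; $+\Delta{\sim}q\in E$; some $s\in R[{\sim}q]$ has $+d'A(s)$ and $r\not>s$. * Support, for $(d,d')=(\sigma,\delta)$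 and $(d,d')=(\sigma^*,\delta^*)$. $+d\,q\in\mathcal T_D(E)$ iff $+\Delta q\in E$, or some $r\in R_{sd}[q]$ has $+d\,A(r)$ and for each $s\in R[{\sim}q]$ either $-d'A(s)$ or $s\not>r$. $-d\,q\in\mathcal T_D(E)$ iff $-\Delta q\in E$ and for each $r\in R_{sd}[q]$ either $-d\,A(r)$ or some $s\in R[{\sim}q]$ has $+d'A(s)$ and $s>r$. $DL(d)$ denotes the logic with principal tag $d\in\{\partial,\delta,\partial^*,\delta^*\}$. The sum $D+A$ of theories with disjoint label sets is their componentwise union. Given theories $D$ and $D'$, a theory $A$ is a *modular* addition if $\Sigma(A)\cap\Sigma(D')\subseteq\Sigma(D)$, $\Lambda(D)\cap\Lambda(A)=\emptyset$ and $\Lambda(D')\cap\Lambda(A)=\emptyset$. The logic $DL(d_2)$ *can simulate* $DL(d_1)$ *with respect to addition of rules* if for every defeasible theory $D$ (leaving infinitely many literals and labels unused) there is a defeasible theory $D'$, using only finitely many literals and labels that do not occur in $D$, such that for every modular addition $A=(\emptyset,R_A,\emptyset)$ and every $q\in\Sigma(D+A)$: $+d_1q$ is a conclusion of $D+A$ iff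 $+d_2q$ is a conclusion of $D'+A$, and $-d_1q$ is a conclusion of $D+A$ iff $-d_2q$ is a conclusion of $D'+A$. **Theorem.** With respect to addition of rules, $DL(\partial^*)$ can simulate $DL(\partial)$, and $DL(\delta^*)$ can simulate $DL(\delta)$. -/

import Mathlib

namespace DefeasibleLogic

/-- Literals over a set `P` of propositions. -/
inductive Lit (P : Type*) where
  | pos (p : P) : Lit P
  | neg (p : P) : Lit P

/-- The complement `∼q` of a literal. -/
def Lit.compl {P : Type*} : Lit P → Lit P
  | .pos p => .neg p
  | .neg p => .pos p

inductive RuleKind where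
  | strict
  | defeasible
  | defeater

/-- A labelled rule: a body, an arrow (the kind), and a head. -/
structure Rule (P L : Type*) where
  label : L
  kind : RuleKind
  body : Set (Lit P)
  head : Lit P

/-- The data `(F, R, >)`; `sup a b` means `a > b`. The conditions that make the triple a
defeasible theory are in `Theory.WellFormed`. -/
structure Theory (P L : Type*) where
  facts : Set (Lit P)
  rules : Set (Rule P L)
  sup : L → L → Prop

/-- The tags: `Δ`, the four principal tags `∂`, `δ`, `∂*`, `δ*`, and the auxiliary (support)
tags `σ`, `σ*` of `δ` and `δ*`. -/
inductive Tag where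
  | Delta
  | partial_
  | delta
  | sigma
  | partialStar
  | deltaStar
  | sigmaStar

/-- `plus d q` is the conclusion `+d q`, and `minus d q` is `-d q`. -/
inductive Conclusion (P : Type*) where
  | plus (d : Tag) (q : Lit P) : Conclusion P
  | minus (d : Tag) (q : Lit P) : Conclusion P

namespace Theory

variable {P L : Type*}

/-- `(F, R, >)` is a defeasible theory: finitely many rules, distinct rules have distinct labels,
and the superiority relation is acyclic. -/
structure WellFormed (D : Theory P L) : Prop where
  finite_rules : D.rules.Finite
  distinct_labels : Set.InjOn Rule.label D.rules
  acyclic : ∀ a : L, ¬ Relation.TransGen D.sup a a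

/-- The rules of `D` with head `q`: `R[q]`. -/
def R (D : Theory P L) (q : Lit P) : Set (Rule P L) :=
  {r | r ∈ D.rules ∧ r.head = q}

/-- The strict rules of `D` with head `q`: `R_s[q]`. -/
def Rs (D : Theory P L) (q : Lit P) : Set (Rule P L) :=
  {r | r ∈ D.R q ∧ r.kind = RuleKind.strict}

/-- The strict or defeasible rules of `D` with head `q`: `R_sd[q]`. -/
def Rsd (D : Theory P L) (q : Lit P) : Set (Rule P L) :=
  {r | r ∈ D.R q ∧ (r.kind = RuleKind.strict ∨ r.kind = RuleKind.defeasible)}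

open Conclusion Tag in
/-- `D.Infers E c`: the conclusion `c` follows from the set `E` of conclusions by one application
of an inference rule. -/
def Infers (D : Theory P L) (E : Set (Conclusion P)) : Conclusion P → Prop
  | plus Delta q =>
      q ∈ D.facts ∨ ∃ r ∈ D.Rs q, ∀ a ∈ r.body, plus Delta a ∈ E
  | minus Delta q =>
      q ∉ D.facts ∧ ∀ r ∈ D.Rs q, ∃ a ∈ r.body, minus Delta a ∈ E
  | plus partial_ q =>
      plus Delta q ∈ E ∨
      ((∃ r ∈ D.Rsd q, ∀ a ∈ r.body, plus partial_ a ∈ E) ∧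
        minus Delta q.compl ∈ E ∧
        ∀ s ∈ D.R q.compl,
          (∃ a ∈ s.body, minus partial_ a ∈ E) ∨
          ∃ t ∈ D.Rsd q, (∀ a ∈ t.body, plus partial_ a ∈ E) ∧ D.sup t.label s.label)
  | minus partial_ q =>
      minus Delta q ∈ E ∧
      ((∀ r ∈ D.Rsd q, ∃ a ∈ r.body, minus partial_ a ∈ E) ∨
        plus Delta q.compl ∈ E ∨
        ∃ s ∈ D.R q.compl, (∀ a ∈ s.body, plus partial_ a ∈ E) ∧
          ∀ t ∈ D.Rsd q,
            (∃ a ∈ t.body, minus partial_ a ∈ E) ∨ ¬ D.sup t.label s.label)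
  | plus delta q =>
      plus Delta q ∈ E ∨
      ((∃ r ∈ D.Rsd q, ∀ a ∈ r.body, plus delta a ∈ E) ∧
        minus Delta q.compl ∈ E ∧
        ∀ s ∈ D.R q.compl,
          (∃ a ∈ s.body, minus sigma a ∈ E) ∨
          ∃ t ∈ D.Rsd q, (∀ a ∈ t.body, plus delta a ∈ E) ∧ D.sup t.label s.label)
  | minus delta q =>
      minus Delta q ∈ E ∧
      ((∀ r ∈ D.Rsd q, ∃ a ∈ r.body, minus delta a ∈ E) ∨
        plus Delta q.compl ∈ E ∨
        ∃ s ∈ D.R q.compl, (∀ a ∈ s.body, plus sigma a ∈ E) ∧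
          ∀ t ∈ D.Rsd q,
            (∃ a ∈ t.body, minus delta a ∈ E) ∨ ¬ D.sup t.label s.label)
  | plus sigma q =>
      plus Delta q ∈ E ∨
      ∃ r ∈ D.Rsd q, (∀ a ∈ r.body, plus sigma a ∈ E) ∧
        ∀ s ∈ D.R q.compl,
          (∃ a ∈ s.body, minus delta a ∈ E) ∨ ¬ D.sup s.label r.label
  | minus sigma q =>
      minus Delta q ∈ E ∧
      ∀ r ∈ D.Rsd q,
        (∃ a ∈ r.body, minus sigma a ∈ E) ∨
        ∃ s ∈ D.R q.compl, (∀ a ∈ s.body, plus delta a ∈ E) ∧ D.sup s.label r.label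
  | plus partialStar q =>
      plus Delta q ∈ E ∨
      ∃ r ∈ D.Rsd q, (∀ a ∈ r.body, plus partialStar a ∈ E) ∧
        minus Delta q.compl ∈ E ∧
        ∀ s ∈ D.R q.compl,
          (∃ a ∈ s.body, minus partialStar a ∈ E) ∨ D.sup r.label s.label
  | minus partialStar q =>
      minus Delta q ∈ E ∧
      ∀ r ∈ D.Rsd q,
        (∃ a ∈ r.body, minus partialStar a ∈ E) ∨
        plus Delta q.compl ∈ E ∨
        ∃ s ∈ D.R q.compl, (∀ a ∈ s.body, plus partialStar a ∈ E) ∧ ¬ D.sup r.label s.label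
  | plus deltaStar q =>
      plus Delta q ∈ E ∨
      ∃ r ∈ D.Rsd q, (∀ a ∈ r.body, plus deltaStar a ∈ E) ∧
        minus Delta q.compl ∈ E ∧
        ∀ s ∈ D.R q.compl,
          (∃ a ∈ s.body, minus sigmaStar a ∈ E) ∨ D.sup r.label s.label
  | minus deltaStar q =>
      minus Delta q ∈ E ∧
      ∀ r ∈ D.Rsd q,
        (∃ a ∈ r.body, minus deltaStar a ∈ E) ∨
        plus Delta q.compl ∈ E ∨
        ∃ s ∈ D.R q.compl, (∀ a ∈ s.body, plus sigmaStar a ∈ E) ∧ ¬ D.sup r.label s.label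
  | plus sigmaStar q =>
      plus Delta q ∈ E ∨
      ∃ r ∈ D.Rsd q, (∀ a ∈ r.body, plus sigmaStar a ∈ E) ∧
        ∀ s ∈ D.R q.compl,
          (∃ a ∈ s.body, minus deltaStar a ∈ E) ∨ ¬ D.sup s.label r.label
  | minus sigmaStar q =>
      minus Delta q ∈ E ∧
      ∀ r ∈ D.Rsd q,
        (∃ a ∈ r.body, minus sigmaStar a ∈ E) ∨
        ∃ s ∈ D.R q.compl, (∀ a ∈ s.body, plus deltaStar a ∈ E) ∧ D.sup s.label r.label

theorem Infers.mono (D : Theory P L) {E E' : Set (Conclusion P)} (h : E ⊆ E')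
    (c : Conclusion P) : D.Infers E c → D.Infers E' c := by
  rcases c with ⟨d, q⟩ | ⟨d, q⟩ <;> cases d <;> simp only [Infers] <;> gcongr

/-- The monotone operator `𝒯_D` on sets of conclusions. -/
def step (D : Theory P L) : Set (Conclusion P) →o Set (Conclusion P) where
  toFun E := {c | D.Infers E c}
  monotone' _ _ h c hc := Infers.mono D h c hc

/-- The set of conclusions of `D`: the least fixed point of `𝒯_D`. The inference rules of each
logic `DL(d)` refer only to `Δ`, `d` and the support tag of `d`, so the conclusions tagged `Δ`
or `d` in this common fixed point are those of `DL(d)`. -/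
def conclusions (D : Theory P L) : Set (Conclusion P) :=
  D.step.lfp

/-- The literals that occur in `D`, as facts or in rules. -/
def occurring (D : Theory P L) : Set (Lit P) :=
  D.facts ∪ {q | ∃ r ∈ D.rules, r.head = q ∨ q ∈ r.body}

/-- The language `Σ(D)`: the closure under complement of the set of literals occurring in `D`. -/
def lits (D : Theory P L) : Set (Lit P) :=
  {q | q ∈ D.occurring ∨ q.compl ∈ D.occurring}

/-- The labels `Λ(D)` that occur in `D`, on rules or in the superiority relation. -/
def labels (D : Theory P L) : Set L :=
  {l | (∃ r ∈ D.rules, r.label = l) ∨ (∃ m, D.sup l m) ∨ ∃ m, D.sup m l}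

/-- The addition `D + A = (F ∪ F', R ∪ R', > ∪ >')`, used when `Λ(D) ∩ Λ(A) = ∅`. -/
def add (D A : Theory P L) : Theory P L where
  facts := D.facts ∪ A.facts
  rules := D.rules ∪ A.rules
  sup a b := D.sup a b ∨ A.sup a b

/-- `A` is a modular addition for `D` and the (possible) simulating theory `D'`. -/
structure Modular (D D' A : Theory P L) : Prop where
  lits_inter : A.lits ∩ D'.lits ⊆ D.lits
  labels_disjoint : Disjoint D.labels A.labels
  labels_disjoint' : Disjoint D'.labels A.labels

/-- `D₁` in the logic `DL(d₁)` is simulated by `D₂` in the logic `DL(d₂)` with respect to the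
class `C` of additions. -/
def SimulatedBy (D₁ : Theory P L) (d₁ : Tag) (D₂ : Theory P L) (d₂ : Tag)
    (C : Set (Theory P L)) : Prop :=
  ∀ A ∈ C, A.WellFormed → Modular D₁ D₂ A →
    ∀ q ∈ (D₁.add A).lits,
      (Conclusion.plus d₁ q ∈ (D₁.add A).conclusions ↔
        Conclusion.plus d₂ q ∈ (D₂.add A).conclusions) ∧
      (Conclusion.minus d₁ q ∈ (D₁.add A).conclusions ↔
        Conclusion.minus d₂ q ∈ (D₂.add A).conclusions)

end Theory

/-- The logic `DL(d₂)` can simulate the logic `DL(d₁)` with respect to additions from `C`: every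
theory in `DL(d₁)` is simulated by some theory in `DL(d₂)`. As usual there is an unlimited supply
of new propositions and labels; the simulating theory uses only finitely many of them, so that it
does not exhaust the vocabulary left for the additions. -/
def CanSimulate {P L : Type*} (d₂ d₁ : Tag) (C : Set (Theory P L)) : Prop :=
  ∀ D : Theory P L, D.WellFormed → D.litsᶜ.Infinite → D.labelsᶜ.Infinite →
    ∃ D' : Theory P L, D'.WellFormed ∧ (D'.lits \ D.lits).Finite ∧ (D'.labels \ D.labels).Finite ∧
      D.SimulatedBy d₁ D' d₂ C

/-- Addition of rules: the additions of the form `(∅, R, ∅)`. -/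
def additionOfRules (P L : Type*) : Set (Theory P L) :=
  {A | A.facts = ∅ ∧ ∀ a b, ¬ A.sup a b}

end DefeasibleLogic

/-!
Superiority is acyclic and there are finitely many rules, so team defeat can be reduced to
individual defeat. Call a rule *unbeaten* when all superior opposing rules have failed bodies.

If the team for `q` wins, take an applicable rule `r` for `q` that no other applicable rule for `q`
lies above through a chain of superiorities. An opponent superior to `r` that does not fail would
be beaten by a team member, which would lie above `r`; hence `r` is unbeaten. Conversely the team
wins as soon as `q` has an applicable rule and every opponent fails or is beaten. So it does no
harm to replace each rule `r` by one whose body says that `r` is applicable and unbeaten: among the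
replaced rules no superiority is needed, and an added rule, which is not superior or inferior to
anything, takes part in the conflict exactly as it does in the original theory.

In the simulating theory `sim`, a new proposition `effective k r` expresses "applicable and
unbeaten": the body of `r` is a reason for it, and the body of each rule that beats `r` is a
superior reason against it. There are two versions. As an attacker, `r` can be beaten only by strict
or defeasible rules, because team members are such; as a supporter it can be beaten by all rules,
because the support tag `σ` is defined so. In the reflection of negative conclusions,
where every supporter fails or is beaten, the same argument with a topmost rule applies
(`exists_top`): a topmost supporter that does not fail would be beaten by an applicable attacker,
and if that attacker does not settle the matter then a rule above the topmost one does not fail.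

Strict rules must keep their effect on `Δ` without acting as unguarded supporters. Their bodies are
routed through a proposition `strictly r`, which an unconditional opposing defeater keeps from
being concluded in any way but strictly.

The tags are treated together by `Mode`: `∂` is its own opposing tag, `δ` and `σ` oppose each
other. Both inclusions of least fixed points are proved by induction
(`Context.conclusions_subset_preserved` and `Context.conclusions_subset_reflected`), the second one
with an interpretation of the new propositions in the original theory.
-/

namespace DefeasibleLogic

open Conclusion

variable {P L : Type*}

theorem Lit.compl_compl (q : Lit P) : q.compl.compl = q := by cases q <;> rfl

/-- A strict or defeasible rule, that is, one that can support its head. -/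
def Rule.Supportive (r : Rule P L) : Prop :=
  r.kind = RuleKind.strict ∨ r.kind = RuleKind.defeasible

/-- The three defeasible forms of inference. Each stands both for a tag with team defeat (or its
support tag) and for the individual-defeat counterpart of that tag. -/
inductive Mode where
  | blocking
  | propagating
  | support

/-- The tags `∂`, `δ`, `σ`. -/
def Mode.tag : Mode → Tag
  | .blocking => .partial_
  | .propagating => .delta
  | .support => .sigma

/-- The tags `∂*`, `δ*`, `σ*`. -/
def Mode.star : Mode → Tag
  | .blocking => .partialStar
  | .propagating => .deltaStar
  | .support => .sigmaStar

/-- The mode in which the bodies of opposing rules are evaluated. -/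
def Mode.opp : Mode → Mode
  | .blocking => .blocking
  | .propagating => .support
  | .support => .propagating

theorem Mode.opp_opp (m : Mode) : m.opp.opp = m := by cases m <;> rfl

/-- The whole body of `r` is concluded positively in `E` with tag `d`. -/
def Applicable (E : Set (Conclusion P)) (d : Tag) (r : Rule P L) : Prop :=
  ∀ a ∈ r.body, plus d a ∈ E

/-- Some literal in the body of `r` is concluded negatively in `E` with tag `d`. -/
def Discarded (E : Set (Conclusion P)) (d : Tag) (r : Rule P L) : Prop :=
  ∃ a ∈ r.body, minus d a ∈ E

namespace Theory

/-! ### The inference rules, uniformly in the tag -/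

theorem mem_conclusions_iff (D : Theory P L) (c : Conclusion P) :
    c ∈ D.conclusions ↔ D.Infers D.conclusions c := by
  have h : D.step D.conclusions = D.conclusions := D.step.map_lfp
  conv_lhs => rw [← h]
  rfl

theorem conclusions_subset (D : Theory P L) {E : Set (Conclusion P)}
    (h : ∀ c, D.Infers E c → c ∈ E) : D.conclusions ⊆ E :=
  D.step.lfp_le h

section Infers

variable (T : Theory P L) (E : Set (Conclusion P)) {m : Mode} (q : Lit P)

theorem infers_plus_Delta : T.Infers E (plus .Delta q) ↔
    q ∈ T.facts ∨ ∃ r ∈ T.Rs q, Applicable E .Delta r := Iff.rfl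

theorem infers_minus_Delta : T.Infers E (minus .Delta q) ↔
    q ∉ T.facts ∧ ∀ r ∈ T.Rs q, Discarded E .Delta r := Iff.rfl

theorem infers_plus_tag (hm : m ≠ .support) : T.Infers E (plus m.tag q) ↔
    plus .Delta q ∈ E ∨ ((∃ r ∈ T.Rsd q, Applicable E m.tag r) ∧ minus .Delta q.compl ∈ E ∧
      ∀ s ∈ T.R q.compl, Discarded E m.opp.tag s ∨
        ∃ t ∈ T.Rsd q, Applicable E m.tag t ∧ T.sup t.label s.label) := by
  cases m <;> first | exact Iff.rfl | exact absurd rfl hm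

theorem infers_minus_tag (hm : m ≠ .support) : T.Infers E (minus m.tag q) ↔
    minus .Delta q ∈ E ∧ ((∀ r ∈ T.Rsd q, Discarded E m.tag r) ∨ plus .Delta q.compl ∈ E ∨
      ∃ s ∈ T.R q.compl, Applicable E m.opp.tag s ∧
        ∀ t ∈ T.Rsd q, Discarded E m.tag t ∨ ¬ T.sup t.label s.label) := by
  cases m <;> first | exact Iff.rfl | exact absurd rfl hm

theorem infers_plus_sigma : T.Infers E (plus Mode.support.tag q) ↔
    plus .Delta q ∈ E ∨ ∃ r ∈ T.Rsd q, Applicable E Mode.support.tag r ∧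
      ∀ s ∈ T.R q.compl, Discarded E Mode.support.opp.tag s ∨ ¬ T.sup s.label r.label := Iff.rfl

theorem infers_minus_sigma : T.Infers E (minus Mode.support.tag q) ↔
    minus .Delta q ∈ E ∧ ∀ r ∈ T.Rsd q, Discarded E Mode.support.tag r ∨
      ∃ s ∈ T.R q.compl, Applicable E Mode.support.opp.tag s ∧ T.sup s.label r.label := Iff.rfl

theorem infers_plus_star (hm : m ≠ .support) : T.Infers E (plus m.star q) ↔
    plus .Delta q ∈ E ∨ ∃ r ∈ T.Rsd q, Applicable E m.star r ∧ minus .Delta q.compl ∈ E ∧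
      ∀ s ∈ T.R q.compl, Discarded E m.opp.star s ∨ T.sup r.label s.label := by
  cases m <;> first | exact Iff.rfl | exact absurd rfl hm

theorem infers_minus_star (hm : m ≠ .support) : T.Infers E (minus m.star q) ↔
    minus .Delta q ∈ E ∧ ∀ r ∈ T.Rsd q, Discarded E m.star r ∨ plus .Delta q.compl ∈ E ∨
      ∃ s ∈ T.R q.compl, Applicable E m.opp.star s ∧ ¬ T.sup r.label s.label := by
  cases m <;> first | exact Iff.rfl | exact absurd rfl hm

theorem infers_plus_sigmaStar : T.Infers E (plus Mode.support.star q) ↔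
    plus .Delta q ∈ E ∨ ∃ r ∈ T.Rsd q, Applicable E Mode.support.star r ∧
      ∀ s ∈ T.R q.compl, Discarded E Mode.support.opp.star s ∨ ¬ T.sup s.label r.label := Iff.rfl

theorem infers_minus_sigmaStar : T.Infers E (minus Mode.support.star q) ↔
    minus .Delta q ∈ E ∧ ∀ r ∈ T.Rsd q, Discarded E Mode.support.star r ∨
      ∃ s ∈ T.R q.compl, Applicable E Mode.support.opp.star s ∧ T.sup s.label r.label := Iff.rfl

end Infers

/-! ### The simulating theory -/

/-- The two roles in which a rule of the original theory takes part in a conflict. -/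
inductive Role where
  | attack
  | support

/-- The new propositions: `effective k r` says that `r` is applicable and not beaten, in the role
`k`; `strictly r` says that the body of `r` is strictly provable. -/
inductive NewProp (R : Type*) where
  | effective (k : Role) (r : R)
  | strictly (r : R)

/-- The labels of the simulating theory, one for each of its potential rules: `intro`, `beat` and
`use` are for the rules that conclude, refute and apply `effective k r`, and the last three
likewise for `strictly r`. -/
inductive NewLabel (R : Type*) where
  | intro (k : Role) (r : R)
  | beat (k : Role) (t r : R)
  | use (k : Role) (r : R)
  | strictIntro (r : R)
  | strictBlock (r : R)
  | strictUse (r : R)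

instance {R : Type*} [Finite R] : Finite (NewProp R) := by
  refine Finite.of_injective (β := Fin 3 × R) (fun
    | .effective .attack r => (0, r)
    | .effective .support r => (1, r)
    | .strictly r => (2, r)) ?_
  rintro (⟨⟨⟩, _⟩ | _) (⟨⟨⟩, _⟩ | _) h <;> simp_all

instance {R : Type*} [Finite R] : Finite (NewLabel R) := by
  refine Finite.of_injective (β := Fin 9 × R × R) (fun
    | .intro .attack r => (0, r, r)
    | .intro .support r => (1, r, r)
    | .beat .attack t r => (2, t, r)
    | .beat .support t r => (3, t, r)
    | .use .attack r => (4, r, r)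
    | .use .support r => (5, r, r)
    | .strictIntro r => (6, r, r)
    | .strictBlock r => (7, r, r)
    | .strictUse r => (8, r, r)) ?_
  rintro (⟨⟨⟩, _⟩ | ⟨⟨⟩, _, _⟩ | ⟨⟨⟩, _⟩ | _ | _ | _)
    (⟨⟨⟩, _⟩ | ⟨⟨⟩, _, _⟩ | ⟨⟨⟩, _⟩ | _ | _ | _) h <;> simp_all

/-- The superiority relation of the simulating theory, on its labels. -/
def NewLabel.Over {R : Type*} : NewLabel R → NewLabel R → Prop
  | .beat k _ r, .intro k' r' => k = k' ∧ r = r'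
  | .strictBlock r, .strictIntro r' => r = r'
  | _, _ => False

/-- `t` is an opposing rule superior to `s`. When `s` attacks, only strict and defeasible rules
count, because defeaters take no part in team defeat; when `s` supports, all rules count, as in
the inference rules for the support tags. -/
def Beats (D : Theory P L) (k : Role) (t s : Rule P L) : Prop :=
  t ∈ D.R s.head.compl ∧ D.sup t.label s.label ∧ (k = .attack → t.Supportive)

/-- Which of the potential rules belong to the simulating theory. -/
def Valid (D : Theory P L) : NewLabel D.rules → Prop
  | .beat k t r => D.Beats k t r
  | .use .support r => r.1.Supportive
  | .strictUse r => r.1.kind = .strict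
  | _ => True

/-- The potential rules of the simulating theory, for a choice `u` of the new propositions and
`ℓ` of the new labels. -/
def simRule (D : Theory P L) (u : NewProp D.rules → P) (ℓ : NewLabel D.rules → L) :
    NewLabel D.rules → Rule P L
  | .intro k r => ⟨ℓ (.intro k r), .defeasible, r.1.body, .pos (u (.effective k r))⟩
  | .beat k t r => ⟨ℓ (.beat k t r), .defeater, t.1.body, .neg (u (.effective k r))⟩
  | .use .attack r =>
      ⟨ℓ (.use .attack r), .defeater, {.pos (u (.effective .attack r))}, r.1.head⟩
  | .use .support r =>
      ⟨ℓ (.use .support r), .defeasible, {.pos (u (.effective .support r))}, r.1.head⟩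
  | .strictIntro r => ⟨ℓ (.strictIntro r), .strict, r.1.body, .pos (u (.strictly r))⟩
  | .strictBlock r => ⟨ℓ (.strictBlock r), .defeater, ∅, .neg (u (.strictly r))⟩
  | .strictUse r => ⟨ℓ (.strictUse r), .strict, {.pos (u (.strictly r))}, r.1.head⟩

/-- The theory that simulates `D` under individual defeat. -/
def sim (D : Theory P L) (u : NewProp D.rules → P) (ℓ : NewLabel D.rules → L) : Theory P L where
  facts := D.facts
  rules := {ρ | ∃ x, D.Valid x ∧ D.simRule u ℓ x = ρ}
  sup a b := ∃ x y, NewLabel.Over x y ∧ ℓ x = a ∧ ℓ y = b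

theorem simRule_label (D : Theory P L) (u : NewProp D.rules → P) (ℓ : NewLabel D.rules → L)
    (x : NewLabel D.rules) : (D.simRule u ℓ x).label = ℓ x := by
  rcases x with _ | _ | ⟨⟨⟩, _⟩ | _ | _ | _ <;> rfl

theorem sim_wellFormed {D : Theory P L} (hD : D.WellFormed) {u : NewProp D.rules → P}
    {ℓ : NewLabel D.rules → L} (hℓ : Function.Injective ℓ) : (D.sim u ℓ).WellFormed where
  finite_rules := by
    have := hD.finite_rules.to_subtype
    refine (Set.finite_range (D.simRule u ℓ)).subset ?_
    rintro _ ⟨x, -, rfl⟩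
    exact ⟨x, rfl⟩
  distinct_labels := by
    rintro _ ⟨x, -, rfl⟩ _ ⟨y, -, rfl⟩ h
    rw [simRule_label, simRule_label] at h
    rw [hℓ h]
  acyclic a h := by
    obtain ⟨b, ⟨x, y, hxy, hxa, rfl⟩, -⟩ := Relation.TransGen.head'_iff.1 h
    obtain ⟨c, -, ⟨x', y', hxy', rfl, hya⟩⟩ := Relation.TransGen.tail'_iff.1 h
    -- No label occurs on both sides of the superiority relation.
    obtain rfl := hℓ (hxa.trans hya.symm)
    cases x <;> cases y <;> cases x' <;> simp_all [NewLabel.Over]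

/-- The literal `q` is not built from a new proposition. -/
def IsOld {R : Type*} (u : NewProp R → P) (q : Lit P) : Prop :=
  ∀ x, q ≠ .pos (u x) ∧ q ≠ .neg (u x)

theorem IsOld.compl {R : Type*} {u : NewProp R → P} {q : Lit P} (h : IsOld u q) :
    IsOld u q.compl := by
  intro x
  have := h x
  cases q <;> simp_all [Lit.compl]

theorem head_mem_lits {D : Theory P L} {r : Rule P L} (h : r ∈ D.rules) : r.head ∈ D.lits :=
  Or.inl (Or.inr ⟨r, h, Or.inl rfl⟩)

theorem body_subset_lits {D : Theory P L} {r : Rule P L} (h : r ∈ D.rules) : r.body ⊆ D.lits :=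
  fun _ ha => Or.inl (Or.inr ⟨r, h, Or.inr ha⟩)

theorem compl_mem_lits {D : Theory P L} {q : Lit P} (h : q ∈ D.lits) : q.compl ∈ D.lits := by
  rcases h with h | h
  · exact Or.inr (by rwa [Lit.compl_compl])
  · exact Or.inl h

theorem lits_add {D A : Theory P L} {q : Lit P} (h : q ∈ (D.add A).lits) :
    q ∈ D.lits ∨ q ∈ A.lits := by
  have key : ∀ a, a ∈ (D.add A).occurring → a ∈ D.occurring ∨ a ∈ A.occurring := by
    rintro a ((h | h) | ⟨r, h | h, hr⟩)
    · exact Or.inl (Or.inl h)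
    · exact Or.inr (Or.inl h)
    · exact Or.inl (Or.inr ⟨r, h, hr⟩)
    · exact Or.inr (Or.inr ⟨r, h, hr⟩)
  rcases h with h | h
  · exact (key _ h).imp Or.inl Or.inl
  · exact (key _ h).imp Or.inr Or.inr

/-- The assumptions under which `D` is compared with its simulating theory: the new propositions
are fresh for `D`, the choices of propositions and labels are injective, and `A` is a modular
addition of rules. -/
structure Context (D A : Theory P L) (u : NewProp D.rules → P) (ℓ : NewLabel D.rules → L) :
    Prop where
  wf : D.WellFormed
  wf_add : A.WellFormed
  u_inj : Function.Injective u
  label_inj : Function.Injective ℓ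
  old_of_mem : ∀ q ∈ D.lits, IsOld u q
  mem_addition : A ∈ additionOfRules P L
  modular : Modular D (D.sim u ℓ) A

namespace Context

variable {D A : Theory P L} {u : NewProp D.rules → P} {ℓ : NewLabel D.rules → L}
  {q : Lit P} {r s t : Rule P L} {l : L} {m : Mode} {E : Set (Conclusion P)}

theorem old_of_mem_add (c : Context D A u ℓ) (h : q ∈ A.lits) : IsOld u q := by
  by_contra hq
  -- Every new proposition is the head of an introduction rule, hence occurs in the simulation.
  have key : ∀ x : NewProp D.rules, Lit.pos (u x) ∈ (D.sim u ℓ).lits := by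
    rintro (⟨k, r⟩ | r)
    · exact head_mem_lits (D := D.sim u ℓ) ⟨.intro k r, trivial, rfl⟩
    · exact head_mem_lits (D := D.sim u ℓ) ⟨.strictIntro r, trivial, rfl⟩
  have hD : q ∈ (D.sim u ℓ).lits := by
    simp only [IsOld, not_forall, not_and_or, not_not] at hq
    obtain ⟨x, rfl | rfl⟩ := hq
    · exact key x
    · exact compl_mem_lits (key x)
  exact hq (c.old_of_mem q (c.modular.lits_inter ⟨h, hD⟩))

theorem old_of_mem_sum (c : Context D A u ℓ) (h : q ∈ (D.add A).lits) : IsOld u q :=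
  (lits_add h).elim (c.old_of_mem q) c.old_of_mem_add

theorem old_body (c : Context D A u ℓ) (h : r ∈ (D.add A).rules) {a : Lit P} (ha : a ∈ r.body) :
    IsOld u a :=
  c.old_of_mem_sum (body_subset_lits h ha)

theorem sup_add (c : Context D A u ℓ) {a b : L} : (D.add A).sup a b ↔ D.sup a b :=
  ⟨fun h => h.resolve_right (c.mem_addition.2 a b), Or.inl⟩

theorem sup_sim_add (c : Context D A u ℓ) {a b : L} :
    ((D.sim u ℓ).add A).sup a b ↔ (D.sim u ℓ).sup a b :=
  ⟨fun h => h.resolve_right (c.mem_addition.2 a b), Or.inl⟩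

theorem label_mem (h : r ∈ A.rules) : r.label ∈ A.labels := Or.inl ⟨r, h, rfl⟩

theorem not_sup_left (c : Context D A u ℓ) (h : r ∈ A.rules) : ¬ (D.add A).sup r.label l := by
  rw [c.sup_add]
  exact fun hs => Set.disjoint_left.1 c.modular.labels_disjoint
    (Or.inr (Or.inl ⟨_, hs⟩)) (label_mem h)

theorem not_sup_right (c : Context D A u ℓ) (h : r ∈ A.rules) : ¬ (D.add A).sup l r.label := by
  rw [c.sup_add]
  exact fun hs => Set.disjoint_left.1 c.modular.labels_disjoint
    (Or.inr (Or.inr ⟨_, hs⟩)) (label_mem h)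

/-- Well-foundedness of superiority: a nonempty set of rules with some property has a member that
is not below any other member, not even through a chain. -/
theorem exists_top (c : Context D A u ℓ) (p : Rule P L → Prop)
    (h : ∃ r ∈ (D.add A).rules, p r) : ∃ r ∈ (D.add A).rules, p r ∧
      ∀ t ∈ (D.add A).rules, p t → ¬ Relation.TransGen (D.add A).sup t.label r.label := by
  have hfin : ((D.add A).rules).Finite := c.wf.finite_rules.union c.wf_add.finite_rules
  have hsup : (D.add A).sup = D.sup := by
    funext a b
    exact propext c.sup_add
  have := hfin.to_subtype
  let rel : (D.add A).rules → (D.add A).rules → Prop :=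
    fun a b => Relation.TransGen (D.add A).sup a.1.label b.1.label
  have : IsTrans _ rel := ⟨fun _ _ _ h h' => Relation.TransGen.trans h h'⟩
  have : Std.Irrefl rel := ⟨fun a h => c.wf.acyclic a.1.label (by rwa [← hsup])⟩
  obtain ⟨r, hr, hp⟩ := h
  obtain ⟨⟨x, hx⟩, hpx, hmin⟩ := (Finite.wellFounded_of_trans_of_irrefl rel).has_min
    {x | p x.1} ⟨⟨r, hr⟩, hp⟩
  exact ⟨x, hx, hpx, fun t ht hpt => hmin ⟨t, ht⟩ hpt⟩

/-! ### The rules of the simulating theory, by head -/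

theorem mem_R_old (hq : IsOld u q) : s ∈ ((D.sim u ℓ).add A).R q ↔ s ∈ A.R q ∨
    (∃ r : D.rules, r.1.head = q ∧ D.simRule u ℓ (.use .attack r) = s) ∨
    (∃ r : D.rules, r.1.head = q ∧ r.1.Supportive ∧ D.simRule u ℓ (.use .support r) = s) ∨
    ∃ r : D.rules, r.1.head = q ∧ r.1.kind = .strict ∧ D.simRule u ℓ (.strictUse r) = s := by
  constructor
  · rintro ⟨⟨x, hx, rfl⟩ | h, hh⟩
    · rcases x with ⟨k, r⟩ | ⟨k, t, r⟩ | ⟨⟨⟩, r⟩ | r | r | r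
      · exact absurd hh.symm (hq _).1
      · exact absurd hh.symm (hq _).2
      · exact Or.inr (Or.inl ⟨r, hh, rfl⟩)
      · exact Or.inr (Or.inr (Or.inl ⟨r, hh, hx, rfl⟩))
      · exact absurd hh.symm (hq _).1
      · exact absurd hh.symm (hq _).2
      · exact Or.inr (Or.inr (Or.inr ⟨r, hh, hx, rfl⟩))
    · exact Or.inl ⟨h, hh⟩
  · rintro (h | ⟨r, hr, rfl⟩ | ⟨r, hr, hs, rfl⟩ | ⟨r, hr, hs, rfl⟩)
    · exact ⟨Or.inr h.1, h.2⟩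
    · exact ⟨Or.inl ⟨.use .attack r, trivial, rfl⟩, hr⟩
    · exact ⟨Or.inl ⟨.use .support r, hs, rfl⟩, hr⟩
    · exact ⟨Or.inl ⟨.strictUse r, hs, rfl⟩, hr⟩

theorem mem_Rsd_old (hq : IsOld u q) : s ∈ ((D.sim u ℓ).add A).Rsd q ↔ s ∈ A.Rsd q ∨
    (∃ r : D.rules, r.1 ∈ D.Rsd q ∧ D.simRule u ℓ (.use .support r) = s) ∨
    ∃ r : D.rules, r.1 ∈ D.Rs q ∧ D.simRule u ℓ (.strictUse r) = s := by
  constructor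
  · rintro ⟨h, hk⟩
    rcases (mem_R_old hq).1 h with h | ⟨r, hr, rfl⟩ | ⟨r, hr, hs, rfl⟩ | ⟨r, hr, hs, rfl⟩
    · exact Or.inl ⟨h, hk⟩
    · simp [simRule] at hk
    · exact Or.inr (Or.inl ⟨r, ⟨⟨r.2, hr⟩, hs⟩, rfl⟩)
    · exact Or.inr (Or.inr ⟨r, ⟨⟨r.2, hr⟩, hs⟩, rfl⟩)
  · rintro (h | ⟨r, hr, rfl⟩ | ⟨r, hr, rfl⟩)
    · exact ⟨(mem_R_old hq).2 (Or.inl h.1), h.2⟩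
    · exact ⟨(mem_R_old hq).2 (Or.inr (Or.inr (Or.inl ⟨r, hr.1.2, hr.2, rfl⟩))), Or.inr rfl⟩
    · exact ⟨(mem_R_old hq).2 (Or.inr (Or.inr (Or.inr ⟨r, hr.1.2, hr.2, rfl⟩))), Or.inl rfl⟩

theorem mem_Rs_old (hq : IsOld u q) : s ∈ ((D.sim u ℓ).add A).Rs q ↔ s ∈ A.Rs q ∨
    ∃ r : D.rules, r.1 ∈ D.Rs q ∧ D.simRule u ℓ (.strictUse r) = s := by
  constructor
  · rintro ⟨h, hk⟩
    rcases (mem_Rsd_old hq).1 ⟨h, Or.inl hk⟩ with h | ⟨r, hr, rfl⟩ | h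
    · exact Or.inl ⟨h.1, hk⟩
    · simp [simRule] at hk
    · exact Or.inr h
  · rintro (h | ⟨r, hr, rfl⟩)
    · exact ⟨((mem_Rsd_old hq).2 (Or.inl ⟨h.1, Or.inl h.2⟩)).1, h.2⟩
    · exact ⟨((mem_Rsd_old hq).2 (Or.inr (Or.inr ⟨r, hr, rfl⟩))).1, rfl⟩

/-- The rules of the simulation for old literals are not superior to any rule. -/
theorem not_sup_of_mem_R_old (c : Context D A u ℓ) (hq : IsOld u q)
    (hs : s ∈ ((D.sim u ℓ).add A).R q) : ¬ ((D.sim u ℓ).add A).sup s.label l := by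
  rw [c.sup_sim_add]
  intro h
  rcases (mem_R_old hq).1 hs with hs | ⟨r, -, rfl⟩ | ⟨r, -, -, rfl⟩ | ⟨r, -, -, rfl⟩
  · exact Set.disjoint_left.1 c.modular.labels_disjoint'
      (Or.inr (Or.inl ⟨_, h⟩)) (label_mem hs.1)
  all_goals
    obtain ⟨x, y, hxy, hx, -⟩ := h
    rw [simRule_label] at hx
    obtain rfl := c.label_inj hx
    simp [NewLabel.Over] at hxy

theorem not_mem_add_of_new (c : Context D A u ℓ) (h : s ∈ A.rules) (x : NewProp D.rules) :
    s.head ≠ .pos (u x) ∧ s.head ≠ .neg (u x) :=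
  c.old_of_mem_add (head_mem_lits h) x

theorem mem_R_effective (c : Context D A u ℓ) (k : Role) (r : D.rules) :
    s ∈ ((D.sim u ℓ).add A).R (.pos (u (.effective k r))) ↔ s = D.simRule u ℓ (.intro k r) := by
  constructor
  · rintro ⟨⟨x, hx, rfl⟩ | h, hh⟩
    · rcases x with ⟨k', r'⟩ | ⟨k', t, r'⟩ | ⟨⟨⟩, r'⟩ | r' | r' | r' <;>
        simp only [simRule, Lit.pos.injEq, reduceCtorEq, c.u_inj.eq_iff,
          NewProp.effective.injEq] at hh
      · obtain ⟨rfl, rfl⟩ := hh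
        rfl
      all_goals exact absurd hh (c.old_of_mem _ (head_mem_lits r'.2) _).1
    · exact absurd hh (c.not_mem_add_of_new h _).1
  · rintro rfl
    exact ⟨Or.inl ⟨.intro k r, trivial, rfl⟩, rfl⟩

theorem mem_R_neg_effective (c : Context D A u ℓ) (k : Role) (r : D.rules) :
    s ∈ ((D.sim u ℓ).add A).R (.neg (u (.effective k r))) ↔
      ∃ t : D.rules, D.Beats k t r ∧ D.simRule u ℓ (.beat k t r) = s := by
  constructor
  · rintro ⟨⟨x, hx, rfl⟩ | h, hh⟩
    · rcases x with ⟨k', r'⟩ | ⟨k', t, r'⟩ | ⟨⟨⟩, r'⟩ | r' | r' | r' <;>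
        simp only [simRule, Lit.neg.injEq, reduceCtorEq, c.u_inj.eq_iff,
          NewProp.effective.injEq] at hh
      · obtain ⟨rfl, rfl⟩ := hh
        exact ⟨t, hx, rfl⟩
      all_goals exact absurd hh (c.old_of_mem _ (head_mem_lits r'.2) _).2
    · exact absurd hh (c.not_mem_add_of_new h _).2
  · rintro ⟨t, ht, rfl⟩
    exact ⟨Or.inl ⟨.beat k t r, ht, rfl⟩, rfl⟩

theorem mem_R_strictly (c : Context D A u ℓ) (r : D.rules) :
    s ∈ ((D.sim u ℓ).add A).R (.pos (u (.strictly r))) ↔ s = D.simRule u ℓ (.strictIntro r) := by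
  constructor
  · rintro ⟨⟨x, hx, rfl⟩ | h, hh⟩
    · rcases x with ⟨k', r'⟩ | ⟨k', t, r'⟩ | ⟨⟨⟩, r'⟩ | r' | r' | r' <;>
        simp only [simRule, Lit.pos.injEq, reduceCtorEq, c.u_inj.eq_iff,
          NewProp.strictly.injEq] at hh
      case strictIntro =>
        obtain rfl := hh
        rfl
      all_goals exact absurd hh (c.old_of_mem _ (head_mem_lits r'.2) _).1
    · exact absurd hh (c.not_mem_add_of_new h _).1
  · rintro rfl
    exact ⟨Or.inl ⟨.strictIntro r, trivial, rfl⟩, rfl⟩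

theorem strictBlock_mem_R (r : D.rules) :
    D.simRule u ℓ (.strictBlock r) ∈ ((D.sim u ℓ).add A).R (.neg (u (.strictly r))) :=
  ⟨Or.inl ⟨.strictBlock r, trivial, rfl⟩, rfl⟩

theorem sup_simRule_iff (c : Context D A u ℓ) {x y : NewLabel D.rules} :
    ((D.sim u ℓ).add A).sup (D.simRule u ℓ x).label (D.simRule u ℓ y).label ↔ x.Over y := by
  rw [c.sup_sim_add, simRule_label, simRule_label]
  constructor
  · rintro ⟨x', y', h, hx, hy⟩
    rwa [← c.label_inj hx, ← c.label_inj hy]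
  · exact fun h => ⟨x, y, h, rfl, rfl⟩

theorem new_not_fact (c : Context D A u ℓ) (x : NewProp D.rules) :
    Lit.pos (u x) ∉ ((D.sim u ℓ).add A).facts ∧ Lit.neg (u x) ∉ ((D.sim u ℓ).add A).facts := by
  have h : ∀ q ∈ ((D.sim u ℓ).add A).facts, IsOld u q := by
    rintro q (h | h)
    · exact c.old_of_mem q (Or.inl (Or.inl h))
    · rw [c.mem_addition.1] at h
      exact h.elim
  exact ⟨fun hf => (h _ hf x).1 rfl, fun hf => (h _ hf x).2 rfl⟩

/-! ### Inference for the new literals -/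

theorem not_infers_plus_Delta_effective (c : Context D A u ℓ) (k : Role) (r : D.rules) :
    ¬ ((D.sim u ℓ).add A).Infers E (plus .Delta (.pos (u (.effective k r)))) := by
  rw [infers_plus_Delta]
  rintro (h | ⟨s, ⟨hs, hk⟩, -⟩)
  · exact (c.new_not_fact _).1 h
  · obtain rfl := (c.mem_R_effective k r).1 hs
    simp [simRule] at hk

theorem minus_Delta_effective (c : Context D A u ℓ) (k : Role) (r : D.rules) :
    minus .Delta (.pos (u (.effective k r))) ∈ ((D.sim u ℓ).add A).conclusions := by
  rw [mem_conclusions_iff, infers_minus_Delta]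
  refine ⟨(c.new_not_fact _).1, ?_⟩
  rintro s ⟨hs, hk⟩
  obtain rfl := (c.mem_R_effective k r).1 hs
  simp [simRule] at hk

theorem not_infers_plus_Delta_neg_effective (c : Context D A u ℓ) (k : Role) (r : D.rules) :
    ¬ ((D.sim u ℓ).add A).Infers E (plus .Delta (.neg (u (.effective k r)))) := by
  rw [infers_plus_Delta]
  rintro (h | ⟨s, ⟨hs, hk⟩, -⟩)
  · exact (c.new_not_fact _).2 h
  · obtain ⟨t, -, rfl⟩ := (c.mem_R_neg_effective k r).1 hs
    simp [simRule] at hk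

theorem minus_Delta_neg_effective (c : Context D A u ℓ) (k : Role) (r : D.rules) :
    minus .Delta (.neg (u (.effective k r))) ∈ ((D.sim u ℓ).add A).conclusions := by
  rw [mem_conclusions_iff, infers_minus_Delta]
  refine ⟨(c.new_not_fact _).2, ?_⟩
  rintro s ⟨hs, hk⟩
  obtain ⟨t, -, rfl⟩ := (c.mem_R_neg_effective k r).1 hs
  simp [simRule] at hk

theorem intro_mem_Rsd (k : Role) (r : D.rules) :
    D.simRule u ℓ (.intro k r) ∈ ((D.sim u ℓ).add A).Rsd (.pos (u (.effective k r))) :=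
  ⟨⟨Or.inl ⟨.intro k r, trivial, rfl⟩, rfl⟩, Or.inr rfl⟩

theorem infers_plus_effective (c : Context D A u ℓ) (k : Role) (r : D.rules)
    (h : ((D.sim u ℓ).add A).Infers E (plus m.star (.pos (u (.effective k r))))) :
    plus .Delta (.pos (u (.effective k r))) ∈ E ∨ (Applicable E m.star r.1 ∧
      ∀ t : D.rules, D.Beats k t r → Discarded E m.opp.star t.1) := by
  by_cases hm : m = .support
  · subst hm
    rw [infers_plus_sigmaStar] at h
    refine h.imp_right ?_
    rintro ⟨s, hs, ha, h⟩
    obtain rfl := (c.mem_R_effective k r).1 hs.1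
    exact ⟨ha, fun t ht => (h _ ((c.mem_R_neg_effective k r).2 ⟨t, ht, rfl⟩)).resolve_right
      (not_not.2 (c.sup_simRule_iff.2 ⟨rfl, rfl⟩))⟩
  · rw [infers_plus_star _ _ _ hm] at h
    refine h.imp_right ?_
    rintro ⟨s, hs, ha, -, h⟩
    obtain rfl := (c.mem_R_effective k r).1 hs.1
    exact ⟨ha, fun t ht => (h _ ((c.mem_R_neg_effective k r).2 ⟨t, ht, rfl⟩)).resolve_right
      fun h' => c.sup_simRule_iff.1 h'⟩

theorem plus_effective (c : Context D A u ℓ) (k : Role) (r : D.rules)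
    (ha : Applicable ((D.sim u ℓ).add A).conclusions m.star r.1)
    (hb : ∀ t : D.rules, D.Beats k t r →
      Discarded ((D.sim u ℓ).add A).conclusions m.opp.star t.1) :
    plus m.star (.pos (u (.effective k r))) ∈ ((D.sim u ℓ).add A).conclusions := by
  rw [mem_conclusions_iff]
  by_cases hm : m = .support
  · subst hm
    rw [infers_plus_sigmaStar]
    refine Or.inr ⟨_, intro_mem_Rsd k r, ha, fun s hs => Or.inl ?_⟩
    obtain ⟨t, ht, rfl⟩ := (c.mem_R_neg_effective k r).1 hs
    exact hb t ht
  · rw [infers_plus_star _ _ _ hm]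
    refine Or.inr ⟨_, intro_mem_Rsd k r, ha, c.minus_Delta_neg_effective k r,
      fun s hs => Or.inl ?_⟩
    obtain ⟨t, ht, rfl⟩ := (c.mem_R_neg_effective k r).1 hs
    exact hb t ht

theorem infers_minus_effective (c : Context D A u ℓ) (k : Role) (r : D.rules)
    (hE : plus .Delta (Lit.neg (u (.effective k r))) ∉ E)
    (h : ((D.sim u ℓ).add A).Infers E (minus m.star (.pos (u (.effective k r))))) :
    Discarded E m.star r.1 ∨ ∃ t : D.rules, D.Beats k t r ∧ Applicable E m.opp.star t.1 := by
  by_cases hm : m = .support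
  · subst hm
    rw [infers_minus_sigmaStar] at h
    refine (h.2 _ (intro_mem_Rsd k r)).imp_right ?_
    rintro ⟨s, hs, ha, -⟩
    obtain ⟨t, ht, rfl⟩ := (c.mem_R_neg_effective k r).1 hs
    exact ⟨t, ht, ha⟩
  · rw [infers_minus_star _ _ _ hm] at h
    rcases h.2 _ (intro_mem_Rsd k r) with h | h | ⟨s, hs, ha, -⟩
    · exact Or.inl h
    · exact absurd h hE
    · obtain ⟨t, ht, rfl⟩ := (c.mem_R_neg_effective k r).1 hs
      exact Or.inr ⟨t, ht, ha⟩

theorem minus_effective (c : Context D A u ℓ) (k : Role) (r : D.rules)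
    (h : Discarded ((D.sim u ℓ).add A).conclusions m.star r.1 ∨ ∃ t : D.rules, D.Beats k t r ∧
      Applicable ((D.sim u ℓ).add A).conclusions m.opp.star t.1) :
    minus m.star (.pos (u (.effective k r))) ∈ ((D.sim u ℓ).add A).conclusions := by
  rw [mem_conclusions_iff]
  by_cases hm : m = .support
  · subst hm
    rw [infers_minus_sigmaStar]
    refine ⟨c.minus_Delta_effective k r, fun s hs => ?_⟩
    obtain rfl := (c.mem_R_effective k r).1 hs.1
    exact h.imp_right fun ⟨t, ht, ha⟩ =>
      ⟨_, (c.mem_R_neg_effective k r).2 ⟨t, ht, rfl⟩, ha, c.sup_simRule_iff.2 ⟨rfl, rfl⟩⟩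
  · rw [infers_minus_star _ _ _ hm]
    refine ⟨c.minus_Delta_effective k r, fun s hs => ?_⟩
    obtain rfl := (c.mem_R_effective k r).1 hs.1
    exact h.imp_right fun ⟨t, ht, ha⟩ => Or.inr
      ⟨_, (c.mem_R_neg_effective k r).2 ⟨t, ht, rfl⟩, ha, fun h' => c.sup_simRule_iff.1 h'⟩

theorem infers_plus_Delta_strictly (c : Context D A u ℓ) (r : D.rules) :
    ((D.sim u ℓ).add A).Infers E (plus .Delta (.pos (u (.strictly r)))) ↔
      Applicable E .Delta r.1 := by
  rw [infers_plus_Delta]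
  constructor
  · rintro (h | ⟨s, ⟨hs, hk⟩, h⟩)
    · exact absurd h (c.new_not_fact _).1
    · obtain rfl := (c.mem_R_strictly r).1 hs
      exact h
  · exact fun h => Or.inr ⟨_, ⟨(c.mem_R_strictly r).2 rfl, rfl⟩, h⟩

theorem infers_minus_Delta_strictly (c : Context D A u ℓ) (r : D.rules) :
    ((D.sim u ℓ).add A).Infers E (minus .Delta (.pos (u (.strictly r)))) ↔
      Discarded E .Delta r.1 := by
  rw [infers_minus_Delta]
  constructor
  · exact fun h => h.2 (D.simRule u ℓ (.strictIntro r)) ⟨(c.mem_R_strictly r).2 rfl, rfl⟩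
  · refine fun h => ⟨(c.new_not_fact _).1, ?_⟩
    rintro s ⟨hs, hk⟩
    obtain rfl := (c.mem_R_strictly r).1 hs
    exact h

theorem not_discarded_strictBlock {d : Tag} (r : D.rules) :
    ¬ Discarded E d (D.simRule u ℓ (.strictBlock r)) := by
  rintro ⟨a, ha, -⟩
  exact ha

/-- The blocking rule prevents any merely defeasible conclusion about `strictly r`. -/
theorem infers_plus_strictly (c : Context D A u ℓ) (r : D.rules)
    (h : ((D.sim u ℓ).add A).Infers E (plus m.star (.pos (u (.strictly r))))) :
    plus .Delta (.pos (u (.strictly r))) ∈ E := by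
  by_cases hm : m = .support
  · subst hm
    rw [infers_plus_sigmaStar] at h
    refine h.resolve_right ?_
    rintro ⟨s, hs, -, h⟩
    obtain rfl := (c.mem_R_strictly r).1 hs.1
    rcases h _ (strictBlock_mem_R r) with h | h
    · exact not_discarded_strictBlock r h
    · exact h (c.sup_simRule_iff.2 rfl)
  · rw [infers_plus_star _ _ _ hm] at h
    refine h.resolve_right ?_
    rintro ⟨s, hs, -, -, h⟩
    obtain rfl := (c.mem_R_strictly r).1 hs.1
    rcases h _ (strictBlock_mem_R r) with h | h
    · exact not_discarded_strictBlock r h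
    · exact c.sup_simRule_iff.1 h

theorem infers_minus_strictly (c : Context D A u ℓ) (r : D.rules) :
    ((D.sim u ℓ).add A).Infers E (minus m.star (.pos (u (.strictly r)))) ↔
      minus .Delta (.pos (u (.strictly r))) ∈ E := by
  by_cases hm : m = .support
  · subst hm
    rw [infers_minus_sigmaStar]
    refine ⟨And.left, fun h => ⟨h, fun s hs => Or.inr ⟨_, strictBlock_mem_R r, ?_, ?_⟩⟩⟩
    · exact fun a ha => ha.elim
    · obtain rfl := (c.mem_R_strictly r).1 hs.1
      exact c.sup_simRule_iff.2 rfl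
  · rw [infers_minus_star _ _ _ hm]
    refine ⟨And.left, fun h => ⟨h, fun s hs =>
      Or.inr (Or.inr ⟨_, strictBlock_mem_R r, ?_, ?_⟩)⟩⟩
    · exact fun a ha => ha.elim
    · obtain rfl := (c.mem_R_strictly r).1 hs.1
      exact fun h' => c.sup_simRule_iff.1 h'

/-! ### Inference for the old literals in the simulation -/

theorem infers_plus_star_old (c : Context D A u ℓ) (hq : IsOld u q) (hm : m ≠ .support) :
    ((D.sim u ℓ).add A).Infers E (plus m.star q) ↔ plus .Delta q ∈ E ∨
      ((∃ r ∈ ((D.sim u ℓ).add A).Rsd q, Applicable E m.star r) ∧ minus .Delta q.compl ∈ E ∧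
        ∀ s ∈ ((D.sim u ℓ).add A).R q.compl, Discarded E m.opp.star s) := by
  rw [infers_plus_star _ _ _ hm]
  refine or_congr_right ⟨?_, ?_⟩
  · rintro ⟨r, hr, ha, hn, h⟩
    exact ⟨⟨r, hr, ha⟩, hn, fun s hs =>
      (h s hs).resolve_right (c.not_sup_of_mem_R_old hq hr.1)⟩
  · rintro ⟨⟨r, hr, ha⟩, hn, h⟩
    exact ⟨r, hr, ha, hn, fun s hs => Or.inl (h s hs)⟩

theorem infers_minus_star_old (c : Context D A u ℓ) (hq : IsOld u q) (hm : m ≠ .support) :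
    ((D.sim u ℓ).add A).Infers E (minus m.star q) ↔ minus .Delta q ∈ E ∧
      ((∀ r ∈ ((D.sim u ℓ).add A).Rsd q, Discarded E m.star r) ∨ plus .Delta q.compl ∈ E ∨
        ∃ s ∈ ((D.sim u ℓ).add A).R q.compl, Applicable E m.opp.star s) := by
  rw [infers_minus_star _ _ _ hm]
  refine and_congr_right fun _ => ⟨fun h => ?_, ?_⟩
  · by_contra! hcon
    obtain ⟨⟨r, hr, hd⟩, hn, hs⟩ := hcon
    rcases h r hr with h | h | ⟨s, hs', ha, -⟩
    · exact hd h
    · exact hn h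
    · exact hs s hs' ha
  · rintro (h | h | ⟨s, hs, ha⟩) r hr
    · exact Or.inl (h r hr)
    · exact Or.inr (Or.inl h)
    · exact Or.inr (Or.inr ⟨s, hs, ha, c.not_sup_of_mem_R_old hq hr.1⟩)

theorem infers_plus_sigmaStar_old (c : Context D A u ℓ) (hq : IsOld u q) :
    ((D.sim u ℓ).add A).Infers E (plus Mode.support.star q) ↔ plus .Delta q ∈ E ∨
      ∃ r ∈ ((D.sim u ℓ).add A).Rsd q, Applicable E Mode.support.star r := by
  rw [infers_plus_sigmaStar]
  refine or_congr_right ⟨fun ⟨r, hr, ha, _⟩ => ⟨r, hr, ha⟩, fun ⟨r, hr, ha⟩ => ⟨r, hr, ha, ?_⟩⟩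
  exact fun s hs => Or.inr (c.not_sup_of_mem_R_old hq.compl hs)

theorem infers_minus_sigmaStar_old (c : Context D A u ℓ) (hq : IsOld u q) :
    ((D.sim u ℓ).add A).Infers E (minus Mode.support.star q) ↔ minus .Delta q ∈ E ∧
      ∀ r ∈ ((D.sim u ℓ).add A).Rsd q, Discarded E Mode.support.star r := by
  rw [infers_minus_sigmaStar]
  refine and_congr_right fun _ => ⟨fun h r hr => (h r hr).resolve_right ?_,
    fun h r hr => Or.inl (h r hr)⟩
  rintro ⟨s, hs, -, h⟩
  exact c.not_sup_of_mem_R_old hq.compl hs h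

theorem applicable_use {d : Tag} {k : Role} {r : D.rules} :
    Applicable E d (D.simRule u ℓ (.use k r)) ↔ plus d (.pos (u (.effective k r))) ∈ E := by
  cases k <;> simp [Applicable, simRule]

theorem discarded_use {d : Tag} {k : Role} {r : D.rules} :
    Discarded E d (D.simRule u ℓ (.use k r)) ↔ minus d (.pos (u (.effective k r))) ∈ E := by
  cases k <;> simp [Discarded, simRule]

theorem applicable_strictUse {d : Tag} {r : D.rules} :
    Applicable E d (D.simRule u ℓ (.strictUse r)) ↔ plus d (.pos (u (.strictly r))) ∈ E := by
  simp [Applicable, simRule]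

theorem discarded_strictUse {d : Tag} {r : D.rules} :
    Discarded E d (D.simRule u ℓ (.strictUse r)) ↔ minus d (.pos (u (.strictly r))) ∈ E := by
  simp [Discarded, simRule]

theorem beats_support_of_beats_attack {t s : Rule P L} (h : D.Beats .attack t s) : D.Beats .support t s :=
  ⟨h.1, h.2.1, nofun⟩

theorem discarded_strictUse_of_minus_Delta (hq : IsOld u q)
    (c : Context D A u ℓ) (h : minus .Delta q ∈ ((D.sim u ℓ).add A).conclusions) {r : D.rules}
    (hr : r.1 ∈ D.Rs q) :
    Discarded ((D.sim u ℓ).add A).conclusions m.star (D.simRule u ℓ (.strictUse r)) := by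
  rw [mem_conclusions_iff, infers_minus_Delta] at h
  have := h.2 _ ((mem_Rs_old hq).2 (Or.inr ⟨r, hr, rfl⟩))
  rw [discarded_strictUse] at this ⊢
  rwa [mem_conclusions_iff, c.infers_minus_strictly]

/-! ### Conclusions of the original theory are preserved -/

/-- The conclusions about old literals whose translation is a conclusion of the simulation. -/
def preserved (D A : Theory P L) (u : NewProp D.rules → P) (ℓ : NewLabel D.rules → L) :
    Set (Conclusion P) :=
  {x | ∀ q, IsOld u q →
    (x = plus .Delta q → plus .Delta q ∈ ((D.sim u ℓ).add A).conclusions) ∧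
    (x = minus .Delta q → minus .Delta q ∈ ((D.sim u ℓ).add A).conclusions) ∧
    ∀ m : Mode, (x = plus m.tag q → plus m.star q ∈ ((D.sim u ℓ).add A).conclusions) ∧
      (x = minus m.tag q → minus m.star q ∈ ((D.sim u ℓ).add A).conclusions)}

theorem applicable_Delta_of_preserved (c : Context D A u ℓ) (hr : r ∈ (D.add A).rules)
    (h : Applicable (preserved D A u ℓ) .Delta r) :
    Applicable ((D.sim u ℓ).add A).conclusions .Delta r :=
  fun a ha => (h a ha a (c.old_body hr ha)).1 rfl

theorem discarded_Delta_of_preserved (c : Context D A u ℓ) (hr : r ∈ (D.add A).rules)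
    (h : Discarded (preserved D A u ℓ) .Delta r) :
    Discarded ((D.sim u ℓ).add A).conclusions .Delta r :=
  let ⟨a, ha, h⟩ := h
  ⟨a, ha, (h a (c.old_body hr ha)).2.1 rfl⟩

theorem applicable_of_preserved (c : Context D A u ℓ) (hr : r ∈ (D.add A).rules)
    (h : Applicable (preserved D A u ℓ) m.tag r) :
    Applicable ((D.sim u ℓ).add A).conclusions m.star r :=
  fun a ha => ((h a ha a (c.old_body hr ha)).2.2 m).1 rfl

theorem discarded_of_preserved (c : Context D A u ℓ) (hr : r ∈ (D.add A).rules)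
    (h : Discarded (preserved D A u ℓ) m.tag r) :
    Discarded ((D.sim u ℓ).add A).conclusions m.star r :=
  let ⟨a, ha, h⟩ := h
  ⟨a, ha, ((h a (c.old_body hr ha)).2.2 m).2 rfl⟩

theorem infers_preserved_plus_Delta (c : Context D A u ℓ) (hq : IsOld u q)
    (h : (D.add A).Infers (preserved D A u ℓ) (plus .Delta q)) :
    plus .Delta q ∈ ((D.sim u ℓ).add A).conclusions := by
  rw [mem_conclusions_iff, infers_plus_Delta]
  refine h.imp_right ?_
  rintro ⟨r, ⟨⟨hr, hh⟩, hk⟩, ha⟩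
  have ha' := c.applicable_Delta_of_preserved hr ha
  rcases hr with hr | hr
  · refine ⟨_, (mem_Rs_old hq).2 (Or.inr ⟨⟨r, hr⟩, ⟨⟨hr, hh⟩, hk⟩, rfl⟩), ?_⟩
    rw [applicable_strictUse, mem_conclusions_iff, c.infers_plus_Delta_strictly]
    exact ha'
  · exact ⟨r, (mem_Rs_old hq).2 (Or.inl ⟨⟨hr, hh⟩, hk⟩), ha'⟩

theorem infers_preserved_minus_Delta (c : Context D A u ℓ) (hq : IsOld u q)
    (h : (D.add A).Infers (preserved D A u ℓ) (minus .Delta q)) :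
    minus .Delta q ∈ ((D.sim u ℓ).add A).conclusions := by
  rw [mem_conclusions_iff, infers_minus_Delta]
  refine ⟨h.1, fun s hs => ?_⟩
  rcases (mem_Rs_old hq).1 hs with hs | ⟨r, hr, rfl⟩
  · exact c.discarded_Delta_of_preserved (Or.inr hs.1.1) (h.2 s ⟨⟨Or.inr hs.1.1, hs.1.2⟩, hs.2⟩)
  · rw [discarded_strictUse, mem_conclusions_iff, c.infers_minus_Delta_strictly]
    exact c.discarded_Delta_of_preserved (Or.inl r.2) (h.2 r ⟨⟨Or.inl r.2, hr.1.2⟩, hr.2⟩)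

/-- A rule of the sum that is applicable and not beaten yields an applicable rule of the
simulation. -/
theorem exists_applicable_of_unbeaten (c : Context D A u ℓ) (hq : IsOld u q)
    (hr : r ∈ (D.add A).Rsd q) (ha : Applicable ((D.sim u ℓ).add A).conclusions m.star r)
    (h : ∀ s ∈ (D.add A).R q.compl, (D.add A).sup s.label r.label →
      Discarded ((D.sim u ℓ).add A).conclusions m.opp.star s) :
    ∃ r ∈ ((D.sim u ℓ).add A).Rsd q, Applicable ((D.sim u ℓ).add A).conclusions m.star r := by
  obtain ⟨⟨hr | hr, rfl⟩, hk⟩ := hr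
  · refine ⟨_, (mem_Rsd_old hq).2 (Or.inr (Or.inl ⟨⟨r, hr⟩, ⟨⟨hr, rfl⟩, hk⟩, rfl⟩)), ?_⟩
    rw [applicable_use]
    exact c.plus_effective _ _ ha fun t ht => h t ⟨Or.inl t.2, ht.1.2⟩ (c.sup_add.2 ht.2.1)
  · exact ⟨r, (mem_Rsd_old hq).2 (Or.inl ⟨⟨hr, rfl⟩, hk⟩), ha⟩

theorem infers_preserved_plus (c : Context D A u ℓ) (hq : IsOld u q)
    (h : (D.add A).Infers (preserved D A u ℓ) (plus m.tag q)) :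
    plus m.star q ∈ ((D.sim u ℓ).add A).conclusions := by
  by_cases hm : m = .support
  · subst hm
    rw [infers_plus_sigma] at h
    rw [mem_conclusions_iff, c.infers_plus_sigmaStar_old hq]
    refine h.imp (fun h => (h q hq).1 rfl) ?_
    rintro ⟨r, hr, ha, h⟩
    exact c.exists_applicable_of_unbeaten hq hr (c.applicable_of_preserved hr.1.1 ha)
      fun s hs hsup => c.discarded_of_preserved hs.1 ((h s hs).resolve_right (not_not.2 hsup))
  · rw [infers_plus_tag _ _ _ hm] at h
    rw [mem_conclusions_iff, c.infers_plus_star_old hq hm]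
    refine h.imp (fun h => (h q hq).1 rfl) ?_
    rintro ⟨⟨r, hr, ha⟩, hn, h⟩
    have hn' := (hn _ hq.compl).2.1 rfl
    refine ⟨?_, hn', ?_⟩
    · -- A top applicable rule is unbeaten: a superior opponent that is not discarded would itself
      -- be beaten by an applicable rule, which lies above the top one.
      obtain ⟨r, hr, ⟨hrq, ha⟩, htop⟩ := c.exists_top
        (fun r => r ∈ (D.add A).Rsd q ∧ Applicable (preserved D A u ℓ) m.tag r)
        ⟨r, hr.1.1, hr, ha⟩
      refine c.exists_applicable_of_unbeaten hq hrq (c.applicable_of_preserved hr ha)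
        fun s hs hsup => c.discarded_of_preserved hs.1 ((h s hs).resolve_right ?_)
      rintro ⟨t, ht, hta, hts⟩
      exact htop t ht.1.1 ⟨ht, hta⟩ (.tail (.single hts) hsup)
    · have key : ∀ r : D.rules, r.1.head = q.compl →
          Discarded ((D.sim u ℓ).add A).conclusions m.opp.star r.1 ∨
          ∃ t : D.rules, D.Beats .attack t r ∧
            Applicable ((D.sim u ℓ).add A).conclusions m.opp.opp.star t.1 := by
        intro r hr
        refine (h r ⟨Or.inl r.2, hr⟩).imp (c.discarded_of_preserved (Or.inl r.2)) ?_
        rintro ⟨t, ht, hta, hts⟩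
        have htD : t ∈ D.rules := ht.1.1.resolve_right fun htA => c.not_sup_left htA hts
        refine ⟨⟨t, htD⟩, ⟨⟨htD, ?_⟩, c.sup_add.1 hts, fun _ => ht.2⟩, ?_⟩
        · rw [hr, Lit.compl_compl]
          exact ht.1.2
        · rw [Mode.opp_opp]
          exact c.applicable_of_preserved ht.1.1 hta
      intro s hs
      rcases (mem_R_old hq.compl).1 hs with hs | ⟨r, hr, rfl⟩ | ⟨r, hr, -, rfl⟩ | ⟨r, hr, hk, rfl⟩
      · refine c.discarded_of_preserved (Or.inr hs.1)
          ((h s ⟨Or.inr hs.1, hs.2⟩).resolve_right ?_)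
        rintro ⟨t, -, -, hts⟩
        exact c.not_sup_right hs.1 hts
      · exact discarded_use.2 (c.minus_effective _ _ (key r hr))
      · exact discarded_use.2 (c.minus_effective _ _
          ((key r hr).imp_right fun ⟨t, ht, hta⟩ => ⟨t, beats_support_of_beats_attack ht, hta⟩))
      · exact discarded_strictUse_of_minus_Delta hq.compl c hn' ⟨⟨r.2, hr⟩, hk⟩

theorem infers_preserved_minus (c : Context D A u ℓ) (hq : IsOld u q)
    (h : (D.add A).Infers (preserved D A u ℓ) (minus m.tag q)) :
    minus m.star q ∈ ((D.sim u ℓ).add A).conclusions := by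
  by_cases hm : m = .support
  · subst hm
    rw [infers_minus_sigma] at h
    rw [mem_conclusions_iff, c.infers_minus_sigmaStar_old hq]
    have hn' := (h.1 q hq).2.1 rfl
    refine ⟨hn', fun s hs => ?_⟩
    rcases (mem_Rsd_old hq).1 hs with hs | ⟨r, hr, rfl⟩ | ⟨r, hr, rfl⟩
    · refine c.discarded_of_preserved (Or.inr hs.1.1)
        ((h.2 s ⟨⟨Or.inr hs.1.1, hs.1.2⟩, hs.2⟩).resolve_right ?_)
      rintro ⟨t, -, -, hts⟩
      exact c.not_sup_right hs.1.1 hts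
    · refine discarded_use.2 (c.minus_effective _ _ ?_)
      refine (h.2 r ⟨⟨Or.inl r.2, hr.1.2⟩, hr.2⟩).imp
        (c.discarded_of_preserved (Or.inl r.2)) ?_
      rintro ⟨t, ht, hta, hts⟩
      have htD : t ∈ D.rules := ht.1.resolve_right fun htA => c.not_sup_left htA hts
      refine ⟨⟨t, htD⟩, ⟨⟨htD, ?_⟩, c.sup_add.1 hts, nofun⟩, c.applicable_of_preserved ht.1 hta⟩
      rw [hr.1.2]
      exact ht.2
    · exact discarded_strictUse_of_minus_Delta hq c hn' hr
  · rw [infers_minus_tag _ _ _ hm] at h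
    rw [mem_conclusions_iff, c.infers_minus_star_old hq hm]
    have hn' := (h.1 q hq).2.1 rfl
    refine ⟨hn', h.2.imp (fun h s hs => ?_) (Or.imp (fun h => (h _ hq.compl).1 rfl) ?_)⟩
    · rcases (mem_Rsd_old hq).1 hs with hs | ⟨r, hr, rfl⟩ | ⟨r, hr, rfl⟩
      · exact c.discarded_of_preserved (Or.inr hs.1.1) (h s ⟨⟨Or.inr hs.1.1, hs.1.2⟩, hs.2⟩)
      · exact discarded_use.2 (c.minus_effective _ _ (Or.inl
          (c.discarded_of_preserved (Or.inl r.2) (h r ⟨⟨Or.inl r.2, hr.1.2⟩, hr.2⟩))))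
      · exact discarded_strictUse_of_minus_Delta hq c hn' hr
    · rintro ⟨s, ⟨hs, hh⟩, ha, h⟩
      have ha' := c.applicable_of_preserved hs ha
      rcases hs with hs | hs
      · refine ⟨_, (mem_R_old hq.compl).2 (Or.inr (Or.inl ⟨⟨s, hs⟩, hh, rfl⟩)), ?_⟩
        refine applicable_use.2 (c.plus_effective _ _ ha' fun t ht => ?_)
        have htq : t.1.head = q := by
          rw [ht.1.2, hh, Lit.compl_compl]
        rw [Mode.opp_opp]
        exact c.discarded_of_preserved (Or.inl t.2)
          ((h t ⟨⟨Or.inl t.2, htq⟩, ht.2.2 rfl⟩).resolve_right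
            (not_not.2 (c.sup_add.2 ht.2.1)))
      · exact ⟨s, (mem_R_old hq.compl).2 (Or.inl ⟨hs, hh⟩), ha'⟩

theorem conclusions_subset_preserved (c : Context D A u ℓ) :
    (D.add A).conclusions ⊆ preserved D A u ℓ := by
  refine conclusions_subset _ fun x hx q hq => ⟨?_, ?_, fun m => ⟨?_, ?_⟩⟩
  · rintro rfl
    exact c.infers_preserved_plus_Delta hq hx
  · rintro rfl
    exact c.infers_preserved_minus_Delta hq hx
  · rintro rfl
    exact c.infers_preserved_plus hq hx
  · rintro rfl
    exact c.infers_preserved_minus hq hx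

/-! ### Conclusions of the simulation are reflected -/

/-- The conclusions that are sound when read in the original sum: an old literal stands for
itself, `effective k r` for "`r` is applicable and the rules that beat it are discarded", and
`strictly r` for the strict provability of the body of `r`, whatever the tag. Nothing is required
of the negated new propositions, except that they are not strictly provable. -/
def reflected (D A : Theory P L) (u : NewProp D.rules → P) : Set (Conclusion P) :=
  {x | (∀ q, IsOld u q →
      (x = plus .Delta q → plus .Delta q ∈ (D.add A).conclusions) ∧
      (x = minus .Delta q → minus .Delta q ∈ (D.add A).conclusions) ∧
      ∀ m : Mode, (x = plus m.star q → plus m.tag q ∈ (D.add A).conclusions) ∧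
        (x = minus m.star q → minus m.tag q ∈ (D.add A).conclusions)) ∧
    (∀ k r, x ≠ plus .Delta (.pos (u (.effective k r))) ∧
      x ≠ plus .Delta (.neg (u (.effective k r))) ∧
      ∀ m : Mode, (x = plus m.star (.pos (u (.effective k r))) →
          Applicable (D.add A).conclusions m.tag r.1 ∧
            ∀ t : D.rules, D.Beats k t r → Discarded (D.add A).conclusions m.opp.tag t.1) ∧
        (x = minus m.star (.pos (u (.effective k r))) →
          Discarded (D.add A).conclusions m.tag r.1 ∨
            ∃ t : D.rules, D.Beats k t r ∧ Applicable (D.add A).conclusions m.opp.tag t.1)) ∧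
    ∀ r, (x = plus .Delta (.pos (u (.strictly r))) →
        Applicable (D.add A).conclusions .Delta r.1) ∧
      (x = minus .Delta (.pos (u (.strictly r))) →
        Discarded (D.add A).conclusions .Delta r.1) ∧
      ∀ m : Mode, (x = plus m.star (.pos (u (.strictly r))) →
        Applicable (D.add A).conclusions .Delta r.1)}

theorem applicable_Delta_of_reflected (c : Context D A u ℓ) (hr : r ∈ (D.add A).rules)
    (h : Applicable (reflected D A u) .Delta r) : Applicable (D.add A).conclusions .Delta r :=
  fun a ha => ((h a ha).1 a (c.old_body hr ha)).1 rfl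

theorem discarded_Delta_of_reflected (c : Context D A u ℓ) (hr : r ∈ (D.add A).rules)
    (h : Discarded (reflected D A u) .Delta r) : Discarded (D.add A).conclusions .Delta r :=
  let ⟨a, ha, h⟩ := h
  ⟨a, ha, (h.1 a (c.old_body hr ha)).2.1 rfl⟩

theorem applicable_of_reflected (c : Context D A u ℓ) (hr : r ∈ (D.add A).rules)
    (h : Applicable (reflected D A u) m.star r) : Applicable (D.add A).conclusions m.tag r :=
  fun a ha => (((h a ha).1 a (c.old_body hr ha)).2.2 m).1 rfl

theorem discarded_of_reflected (c : Context D A u ℓ) (hr : r ∈ (D.add A).rules)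
    (h : Discarded (reflected D A u) m.star r) : Discarded (D.add A).conclusions m.tag r :=
  let ⟨a, ha, h⟩ := h
  ⟨a, ha, ((h.1 a (c.old_body hr ha)).2.2 m).2 rfl⟩

theorem infers_reflected_plus_Delta (c : Context D A u ℓ) (hq : IsOld u q)
    (h : ((D.sim u ℓ).add A).Infers (reflected D A u) (plus .Delta q)) :
    plus .Delta q ∈ (D.add A).conclusions := by
  rw [mem_conclusions_iff, infers_plus_Delta]
  refine h.imp_right ?_
  rintro ⟨s, hs, ha⟩
  rcases (mem_Rs_old hq).1 hs with hs | ⟨r, hr, rfl⟩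
  · exact ⟨s, ⟨⟨Or.inr hs.1.1, hs.1.2⟩, hs.2⟩, c.applicable_Delta_of_reflected (Or.inr hs.1.1) ha⟩
  · exact ⟨r, ⟨⟨Or.inl r.2, hr.1.2⟩, hr.2⟩, ((applicable_strictUse.1 ha).2.2 r).1 rfl⟩

theorem infers_reflected_minus_Delta (c : Context D A u ℓ) (hq : IsOld u q)
    (h : ((D.sim u ℓ).add A).Infers (reflected D A u) (minus .Delta q)) :
    minus .Delta q ∈ (D.add A).conclusions := by
  rw [infers_minus_Delta] at h
  rw [mem_conclusions_iff, infers_minus_Delta]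
  refine ⟨h.1, ?_⟩
  rintro r ⟨⟨hr | hr, hh⟩, hk⟩
  · exact ((discarded_strictUse.1 (h.2 _ ((mem_Rs_old hq).2
      (Or.inr ⟨⟨r, hr⟩, ⟨⟨hr, hh⟩, hk⟩, rfl⟩)))).2.2 ⟨r, hr⟩).2.1 rfl
  · exact c.discarded_Delta_of_reflected (Or.inr hr)
      (h.2 r ((mem_Rs_old hq).2 (Or.inl ⟨⟨hr, hh⟩, hk⟩)))

/-- An applicable supporting rule of the simulation comes from an unbeaten applicable rule of the
sum, unless the conclusion is strict. -/
theorem exists_unbeaten_of_reflected (c : Context D A u ℓ) (hq : IsOld u q)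
    (hs : s ∈ ((D.sim u ℓ).add A).Rsd q) (ha : Applicable (reflected D A u) m.star s) :
    plus .Delta q ∈ (D.add A).conclusions ∨
      ∃ r ∈ (D.add A).Rsd q, Applicable (D.add A).conclusions m.tag r ∧
        ∀ s ∈ (D.add A).R q.compl,
          Discarded (D.add A).conclusions m.opp.tag s ∨ ¬ (D.add A).sup s.label r.label := by
  rcases (mem_Rsd_old hq).1 hs with hs | ⟨r, hr, rfl⟩ | ⟨r, hr, rfl⟩
  · exact Or.inr ⟨s, ⟨⟨Or.inr hs.1.1, hs.1.2⟩, hs.2⟩, c.applicable_of_reflected (Or.inr hs.1.1) ha,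
      fun t _ => Or.inr (c.not_sup_right hs.1.1)⟩
  · have := (((applicable_use.1 ha).2.1 .support r).2.2 m).1 rfl
    refine Or.inr ⟨r, ⟨⟨Or.inl r.2, hr.1.2⟩, hr.2⟩, this.1, fun t ht => ?_⟩
    rw [or_iff_not_imp_right, not_not]
    intro hts
    have htD : t ∈ D.rules := ht.1.resolve_right fun htA => c.not_sup_left htA hts
    refine this.2 ⟨t, htD⟩ ⟨⟨htD, ?_⟩, c.sup_add.1 hts, nofun⟩
    rw [hr.1.2]
    exact ht.2
  · left
    rw [mem_conclusions_iff, infers_plus_Delta]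
    exact Or.inr ⟨r, ⟨⟨Or.inl r.2, hr.1.2⟩, hr.2⟩,
      ((applicable_strictUse.1 ha).2.2 r).2.2 m rfl⟩

theorem infers_reflected_plus (c : Context D A u ℓ) (hq : IsOld u q)
    (h : ((D.sim u ℓ).add A).Infers (reflected D A u) (plus m.star q)) :
    plus m.tag q ∈ (D.add A).conclusions := by
  rw [mem_conclusions_iff]
  by_cases hm : m = .support
  · subst hm
    rw [c.infers_plus_sigmaStar_old hq] at h
    rw [infers_plus_sigma]
    rcases h with h | ⟨s, hs, ha⟩
    · exact Or.inl ((h.1 q hq).1 rfl)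
    · exact c.exists_unbeaten_of_reflected hq hs ha
  · rw [c.infers_plus_star_old hq hm] at h
    rw [infers_plus_tag _ _ _ hm]
    rcases h with h | ⟨⟨s, hs, ha⟩, hn, h⟩
    · exact Or.inl ((h.1 q hq).1 rfl)
    refine (c.exists_unbeaten_of_reflected hq hs ha).imp_right ?_
    rintro ⟨r, hr, ha, -⟩
    refine ⟨⟨r, hr, ha⟩, (hn.1 _ hq.compl).2.1 rfl, ?_⟩
    rintro s ⟨hs | hs, hh⟩
    · have := (((discarded_use.1 (h _ ((mem_R_old hq.compl).2
        (Or.inr (Or.inl ⟨⟨s, hs⟩, hh, rfl⟩))))).2.1 .attack ⟨s, hs⟩).2.2 m.opp).2 rfl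
      refine this.imp_right ?_
      rintro ⟨t, ht, hta⟩
      refine ⟨t, ⟨⟨Or.inl t.2, ?_⟩, ht.2.2 rfl⟩, ?_, c.sup_add.2 ht.2.1⟩
      · rw [ht.1.2, hh, Lit.compl_compl]
      · rwa [Mode.opp_opp] at hta
    · exact Or.inl (c.discarded_of_reflected (Or.inr hs)
        (h s ((mem_R_old hq.compl).2 (Or.inl ⟨hs, hh⟩))))

/-- If all supporting rules of the simulation are discarded, then each supporting rule of the sum
is discarded or beaten. -/
theorem discarded_or_beaten_of_reflected (c : Context D A u ℓ) (hq : IsOld u q)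
    (h : ∀ r ∈ ((D.sim u ℓ).add A).Rsd q, Discarded (reflected D A u) m.star r)
    (hr : r ∈ (D.add A).Rsd q) : Discarded (D.add A).conclusions m.tag r ∨
      ∃ s ∈ (D.add A).R q.compl, Applicable (D.add A).conclusions m.opp.tag s ∧
        (D.add A).sup s.label r.label := by
  obtain ⟨⟨hr | hr, rfl⟩, hk⟩ := hr
  · have := (((discarded_use.1 (h _ ((mem_Rsd_old hq).2
      (Or.inr (Or.inl ⟨⟨r, hr⟩, ⟨⟨hr, rfl⟩, hk⟩, rfl⟩))))).2.1 .support ⟨r, hr⟩).2.2 m).2 rfl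
    exact this.imp_right fun ⟨t, ht, hta⟩ =>
      ⟨t, ⟨Or.inl t.2, ht.1.2⟩, hta, c.sup_add.2 ht.2.1⟩
  · exact Or.inl (c.discarded_of_reflected (Or.inr hr)
      (h r ((mem_Rsd_old hq).2 (Or.inl ⟨⟨hr, rfl⟩, hk⟩))))

theorem infers_reflected_minus (c : Context D A u ℓ) (hq : IsOld u q)
    (h : ((D.sim u ℓ).add A).Infers (reflected D A u) (minus m.star q)) :
    minus m.tag q ∈ (D.add A).conclusions := by
  rw [mem_conclusions_iff]
  by_cases hm : m = .support
  · subst hm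
    rw [c.infers_minus_sigmaStar_old hq] at h
    rw [infers_minus_sigma]
    exact ⟨(h.1.1 q hq).2.1 rfl, fun r hr => c.discarded_or_beaten_of_reflected hq h.2 hr⟩
  · rw [c.infers_minus_star_old hq hm] at h
    rw [infers_minus_tag _ _ _ hm]
    refine ⟨(h.1.1 q hq).2.1 rfl, ?_⟩
    rcases h.2 with h | h | ⟨s, hs, ha⟩
    · by_contra! hcon
      obtain ⟨⟨r, hr, hd⟩, -, hcon⟩ := hcon
      -- A top rule that is not discarded is beaten by an applicable rule, and that one in turn by
      -- a rule that is not discarded, which lies above the top one.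
      obtain ⟨r, -, ⟨hr, hd⟩, htop⟩ := c.exists_top
        (fun r => r ∈ (D.add A).Rsd q ∧ ¬ Discarded (D.add A).conclusions m.tag r)
        ⟨r, hr.1.1, hr, hd⟩
      obtain ⟨s, hs, ha, hsr⟩ := (c.discarded_or_beaten_of_reflected hq h hr).resolve_left hd
      obtain ⟨t, ht, htd, hts⟩ := hcon s hs ha
      exact htop t ht.1.1 ⟨ht, htd⟩ (.tail (.single hts) hsr)
    · exact Or.inr (Or.inl ((h.1 _ hq.compl).1 rfl))
    · have key : ∀ (k : Role) (r : D.rules), r.1.head = q.compl →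
          Applicable (reflected D A u) m.opp.star (D.simRule u ℓ (.use k r)) →
          ∃ s ∈ (D.add A).R q.compl, Applicable (D.add A).conclusions m.opp.tag s ∧
            ∀ t ∈ (D.add A).Rsd q, Discarded (D.add A).conclusions m.tag t ∨
              ¬ (D.add A).sup t.label s.label := by
        intro k r hr ha
        have := (((applicable_use.1 ha).2.1 k r).2.2 m.opp).1 rfl
        refine ⟨r, ⟨Or.inl r.2, hr⟩, this.1, fun t ht => ?_⟩
        rw [or_iff_not_imp_right, not_not]
        intro hts
        have htD : t ∈ D.rules := ht.1.1.resolve_right fun htA => c.not_sup_left htA hts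
        have := this.2 ⟨t, htD⟩ ⟨⟨htD, ?_⟩, c.sup_add.1 hts, fun _ => ht.2⟩
        · rwa [Mode.opp_opp] at this
        · rw [hr, Lit.compl_compl]
          exact ht.1.2
      rcases (mem_R_old hq.compl).1 hs with hs | ⟨r, hr, rfl⟩ | ⟨r, hr, -, rfl⟩ | ⟨r, hr, hk, rfl⟩
      · exact Or.inr (Or.inr ⟨s, ⟨Or.inr hs.1, hs.2⟩, c.applicable_of_reflected (Or.inr hs.1) ha,
          fun t _ => Or.inr (c.not_sup_right hs.1)⟩)
      · exact Or.inr (Or.inr (key _ r hr ha))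
      · exact Or.inr (Or.inr (key _ r hr ha))
      · refine Or.inr (Or.inl ?_)
        rw [mem_conclusions_iff, infers_plus_Delta]
        exact Or.inr ⟨r, ⟨⟨Or.inl r.2, hr⟩, hk⟩,
          ((applicable_strictUse.1 ha).2.2 r).2.2 m.opp rfl⟩

theorem conclusions_subset_reflected (c : Context D A u ℓ) :
    ((D.sim u ℓ).add A).conclusions ⊆ reflected D A u := by
  refine conclusions_subset _ fun x hx => ⟨fun q hq => ⟨?_, ?_, fun m => ⟨?_, ?_⟩⟩,
    fun k r => ⟨?_, ?_, fun m => ⟨?_, ?_⟩⟩, fun r => ⟨?_, ?_, fun m => ?_⟩⟩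
  · rintro rfl
    exact c.infers_reflected_plus_Delta hq hx
  · rintro rfl
    exact c.infers_reflected_minus_Delta hq hx
  · rintro rfl
    exact c.infers_reflected_plus hq hx
  · rintro rfl
    exact c.infers_reflected_minus hq hx
  · rintro rfl
    exact c.not_infers_plus_Delta_effective k r hx
  · rintro rfl
    exact c.not_infers_plus_Delta_neg_effective k r hx
  · rintro rfl
    have h := (c.infers_plus_effective k r hx).resolve_left
      fun h => (h.2.1 k r).1 rfl
    exact ⟨c.applicable_of_reflected (Or.inl r.2) h.1,
      fun t ht => c.discarded_of_reflected (Or.inl t.2) (h.2 t ht)⟩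
  · rintro rfl
    refine (c.infers_minus_effective k r (fun h => (h.2.1 k r).2.1 rfl) hx).imp
      (c.discarded_of_reflected (Or.inl r.2)) ?_
    exact fun ⟨t, ht, hta⟩ => ⟨t, ht, c.applicable_of_reflected (Or.inl t.2) hta⟩
  · rintro rfl
    exact c.applicable_Delta_of_reflected (Or.inl r.2) ((c.infers_plus_Delta_strictly r).1 hx)
  · rintro rfl
    exact c.discarded_Delta_of_reflected (Or.inl r.2) ((c.infers_minus_Delta_strictly r).1 hx)
  · rintro rfl
    exact ((c.infers_plus_strictly r hx).2.2 r).1 rfl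

theorem plus_iff (c : Context D A u ℓ) (hq : IsOld u q) (m : Mode) :
    plus m.tag q ∈ (D.add A).conclusions ↔
      plus m.star q ∈ ((D.sim u ℓ).add A).conclusions :=
  ⟨fun h => ((c.conclusions_subset_preserved h q hq).2.2 m).1 rfl,
    fun h => (((c.conclusions_subset_reflected h).1 q hq).2.2 m).1 rfl⟩

theorem minus_iff (c : Context D A u ℓ) (hq : IsOld u q) (m : Mode) :
    minus m.tag q ∈ (D.add A).conclusions ↔
      minus m.star q ∈ ((D.sim u ℓ).add A).conclusions :=
  ⟨fun h => ((c.conclusions_subset_preserved h q hq).2.2 m).2 rfl,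
    fun h => (((c.conclusions_subset_reflected h).1 q hq).2.2 m).2 rfl⟩

end Context

/-! ### The simulation -/

theorem exists_injective_mem {α β : Type*} [Finite β] {S : Set α} (hS : S.Infinite) :
    ∃ f : β → α, Function.Injective f ∧ ∀ b, f b ∈ S := by
  have := hS.to_subtype
  obtain ⟨n, ⟨e⟩⟩ := Finite.exists_equiv_fin β
  refine ⟨fun b => Infinite.natEmbedding S (e b), fun a b h => ?_, fun b =>
    (Infinite.natEmbedding S (e b)).2⟩
  exact e.injective (Fin.val_injective
    ((Infinite.natEmbedding S).injective (Subtype.val_injective h)))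

theorem infinite_fresh_props {D : Theory P L} (h : D.litsᶜ.Infinite) :
    {p : P | Lit.pos p ∉ D.lits}.Infinite := by
  intro hfin
  refine h (((hfin.image Lit.pos).union (hfin.image Lit.neg)).subset ?_)
  rintro (p | p) hp
  · exact Or.inl ⟨p, hp, rfl⟩
  · exact Or.inr ⟨p, fun h' => hp (compl_mem_lits h'), rfl⟩

theorem sim_lits_diff_finite {D : Theory P L} (hD : D.WellFormed) (u : NewProp D.rules → P)
    (ℓ : NewLabel D.rules → L) : ((D.sim u ℓ).lits \ D.lits).Finite := by
  have := hD.finite_rules.to_subtype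
  refine ((Set.finite_range fun x => Lit.pos (u x)).union
    (Set.finite_range fun x => Lit.neg (u x))).subset ?_
  have key : ∀ a ∈ (D.sim u ℓ).occurring,
      a ∈ D.lits ∨ ∃ x, a = .pos (u x) ∨ a = .neg (u x) := by
    rintro a (h | ⟨_, ⟨x, -, rfl⟩, h⟩)
    · exact Or.inl (Or.inl (Or.inl h))
    · rcases x with ⟨k, r⟩ | ⟨k, t, r⟩ | ⟨⟨⟩, r⟩ | r | r | r <;> rcases h with rfl | h
      case intro.inr => exact Or.inl (body_subset_lits r.2 h)
      case beat.inr => exact Or.inl (body_subset_lits t.2 h)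
      case strictIntro.inr => exact Or.inl (body_subset_lits r.2 h)
      case strictBlock.inr => exact h.elim
      case strictUse.inl => exact Or.inl (show r.1.head ∈ D.lits from head_mem_lits r.2)
      case use.attack.inl => exact Or.inl (show r.1.head ∈ D.lits from head_mem_lits r.2)
      case use.support.inl => exact Or.inl (show r.1.head ∈ D.lits from head_mem_lits r.2)
      case use.attack.inr => exact Or.inr ⟨_, Or.inl h⟩
      case use.support.inr => exact Or.inr ⟨_, Or.inl h⟩
      case strictUse.inr => exact Or.inr ⟨_, Or.inl h⟩
      all_goals first
        | exact Or.inr ⟨_, Or.inl rfl⟩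
        | exact Or.inr ⟨_, Or.inr rfl⟩
  rintro q ⟨h | h, hn⟩
  · obtain ⟨x, rfl | rfl⟩ := (key q h).resolve_left hn
    · exact Or.inl ⟨x, rfl⟩
    · exact Or.inr ⟨x, rfl⟩
  · have hn' : q.compl ∉ D.lits := fun h' => hn (by
      rw [← Lit.compl_compl q]
      exact compl_mem_lits h')
    obtain ⟨x, hx⟩ := (key _ h).resolve_left hn'
    cases q with
    | pos p => exact Or.inl ⟨x, by simpa [Lit.compl, eq_comm] using hx⟩
    | neg p => exact Or.inr ⟨x, by simpa [Lit.compl, eq_comm] using hx⟩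

theorem sim_labels_finite {D : Theory P L} (hD : D.WellFormed) (u : NewProp D.rules → P)
    (ℓ : NewLabel D.rules → L) : (D.sim u ℓ).labels.Finite := by
  have := hD.finite_rules.to_subtype
  refine (Set.finite_range ℓ).subset ?_
  rintro _ (⟨_, ⟨x, -, rfl⟩, rfl⟩ | ⟨_, x, _, -, rfl, -⟩ | ⟨_, _, x, -, -, rfl⟩)
  · exact ⟨x, (simRule_label D u ℓ x).symm⟩
  · exact ⟨x, rfl⟩
  · exact ⟨x, rfl⟩

theorem canSimulate_star (m : Mode) :
    CanSimulate m.star m.tag (additionOfRules P L) := by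
  intro D hD hlits hlabels
  have := hD.finite_rules.to_subtype
  obtain ⟨u, hu, hu'⟩ := exists_injective_mem (β := NewProp D.rules) (infinite_fresh_props hlits)
  obtain ⟨ℓ, hℓ, -⟩ := exists_injective_mem (β := NewLabel D.rules) hlabels
  refine ⟨D.sim u ℓ, sim_wellFormed hD hℓ, sim_lits_diff_finite hD u ℓ,
    (sim_labels_finite hD u ℓ).subset Set.sdiff_subset, fun A hA hAwf hmod q hq => ?_⟩
  have c : Context D A u ℓ :=
    { wf := hD
      wf_add := hAwf
      u_inj := hu
      label_inj := hℓ
      old_of_mem := by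
        rintro q hq x
        refine ⟨?_, ?_⟩ <;> rintro rfl
        · exact hu' x hq
        · exact hu' x (compl_mem_lits hq)
      mem_addition := hA
      modular := hmod }
  exact ⟨c.plus_iff (c.old_of_mem_sum hq) m, c.minus_iff (c.old_of_mem_sum hq) m⟩

end Theory
end DefeasibleLogic

theorem mainTheorem4 {P L : Type*} :
    DefeasibleLogic.CanSimulate DefeasibleLogic.Tag.partialStar DefeasibleLogic.Tag.partial_
      (DefeasibleLogic.additionOfRules P L) ∧
    DefeasibleLogic.CanSimulate DefeasibleLogic.Tag.deltaStar DefeasibleLogic.Tag.delta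
      (DefeasibleLogic.additionOfRules P L) :=
  ⟨DefeasibleLogic.Theory.canSimulate_star .blocking,
    DefeasibleLogic.Theory.canSimulate_star .propagating⟩
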